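/- Let $\mathcal H=\mathcal H_1\otimes\cdots\otimes\mathcal H_n$ be an $n$-partite system with finite-dimensional complex Hilbert spaces $\mathcal H_k$, and let $\rho$ be a state (density operator) on $\mathcal H$. A POVM is a finite family $M=(M_i)_i$ of positive semidefinite operators with $\sum_i M_i=\mathbb 1$. Its observational entropy is $S_M(\rho)=-\sum_i p_i\log(p_i/V_i)$ with $p_i=\operatorname{Tr}(\rho M_i)$ and $V_i=\operatorname{Tr}M_i$ (terms with $p_i=0$ are $0$; $\log$ is the natural logarithm, and any other base rescales every quantity below by the same constant). For a set $\chi$ of POVMs on $\mathcal H$ the entropy gap is $E_\chi(\rho)=\inf_{M\in\chi}S_M(\rho)-S(\rho)$, where $S(\rho)=-\operatorname{Tr}\rho\log\rho$. Consider the following classes of POVMs: - $\mathrm{LO}^*$: tensor products $\Pi^{(1)}\otimes\cdots\otimes\Pi^{(n)}=(\Pi^{(1)}_{i_1}\otimes\cdots\otimes\Pi^{(n)}_{i_n})_{i_1,\dots,i_n}$ of projective measurements $\Pi^{(k)}$ on $\mathcal H_k$ (i.e. POVMs with $\Pi^{(k)}_i\Pi^{(k)}_j=\delta_{ij}\Pi^{(k)}_i$);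 - $\mathrm{SEP}$: POVMs each of whose elements is a finite sum of tensor products $A^{(1)}\otimes\cdots\otimes A^{(n)}$ of positive semidefinite operators $A^{(k)}$ on $\mathcal H_k$; - $\mathrm{PPT}$: POVMs each of whose elements has positive semidefinite partial transpose with respect to every subset of the parties. Let $D(\rho\|\sigma)=\operatorname{Tr}\rho(\log\rho-\log\sigma)$ if $\operatorname{supp}\rho\subseteq\operatorname{supp}\sigma$ and $D(\rho\|\sigma)=+\infty$ otherwise. Define $\Delta_{\mathrm{REQ}}(\rho)$, $\Delta_{\mathrm{REE}}(\rho)$ and $\Delta_{\mathrm{REE,PPT}}(\rho)$ as the infimum of $D(\rho\|\sigma)$ over, respectively, the classically correlated states $\sigma$ (those of the form $\sum_{i_1,\dots,i_n}p_{i_1\dots i_n}|\psi^{(1)}_{i_1}\cdots\psi^{(n)}_{i_n}\rangle\langle\psi^{(1)}_{i_1}\cdots\psi^{(n)}_{i_n}|$ with orthonormal bases $(\psi^{(k)}_i)_i$ of $\mathcal H_k$ and a probability distribution $p$), the separable states $\sigma$ (finite convex combinations of product states), and the states $\sigma$ whose partial transpose with respect to every subset of the parties is positive semidefinite. Theorem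 (REQ and REE). For every such state $\rho$, $$E_{\mathrm{LO}^*}(\rho)=\Delta_{\mathrm{REQ}}(\rho),\qquad E_{\mathrm{SEP}}(\rho)\ge\Delta_{\mathrm{REE}}(\rho),\qquad E_{\mathrm{PPT}}(\rho)\ge\Delta_{\mathrm{REE,PPT}}(\rho).$$ -/

import Mathlib

noncomputable section

namespace EntropyGap

open Matrix
open scoped ComplexOrder

/-! ### States, measurements and entropies on a finite-dimensional Hilbert space

The Hilbert space is `ℂ^X` for a finite index set `X`, and operators are matrices. -/

section General

variable {X : Type} [Fintype X] [DecidableEq X]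

/-- Density operators: positive semidefinite with unit trace. -/
def IsState (ρ : Matrix X X ℂ) : Prop :=
  ρ.PosSemidef ∧ ρ.trace = 1

/-- The operator `|v⟩⟨v|`. -/
def ketbra (v : X → ℂ) : Matrix X X ℂ :=
  Matrix.vecMulVec v (star v)

/-- A POVM with finitely many outcomes. -/
structure POVM (X : Type) [Fintype X] [DecidableEq X] where
  Outcome : Type
  [fintypeOutcome : Fintype Outcome]
  op : Outcome → Matrix X X ℂ
  posSemidef : ∀ i, (op i).PosSemidef
  sum_op : ∑ i, op i = 1

attribute [instance] POVM.fintypeOutcome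

namespace POVM

/-- Projective measurements: `Π_i Π_j = δ_{ij} Π_i`. -/
def IsProjective (M : POVM X) : Prop :=
  (∀ i, M.op i * M.op i = M.op i) ∧ ∀ i j, i ≠ j → M.op i * M.op j = 0

/-- The outcome probability `p_i = Tr (ρ M_i)`. -/
def prob (M : POVM X) (ρ : Matrix X X ℂ) (i : M.Outcome) : ℝ :=
  (ρ * M.op i).trace.re

/-- The macrostate volume `V_i = Tr M_i`. -/
def volume (M : POVM X) (i : M.Outcome) : ℝ :=
  (M.op i).trace.re

/-- Observational entropy `S_M(ρ) = -∑ p_i log (p_i / V_i)`, where outcomes with `p_i = 0`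
(in particular those with `V_i = 0`) contribute `0`. -/
def obsEntropy (M : POVM X) (ρ : Matrix X X ℂ) : ℝ :=
  -∑ i, M.prob ρ i * Real.log (M.prob ρ i / M.volume i)

end POVM

/-- The logarithm of a positive semidefinite operator, taken on its support
(functional calculus, with `Real.log 0 = 0` on the kernel). -/
def opLog (A : Matrix X X ℂ) : Matrix X X ℂ :=
  cfc Real.log A

/-- The von Neumann entropy `S(ρ) = -Tr (ρ log ρ)`. -/
def vonNeumannEntropy (ρ : Matrix X X ℂ) : ℝ :=
  -(ρ * opLog ρ).trace.re

open Classical in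
/-- The quantum relative entropy `D(ρ‖σ) = Tr ρ (log ρ - log σ)` if the kernel of `σ` is contained
in the kernel of `ρ` (that is, `supp ρ ⊆ supp σ`), and `+∞` otherwise. -/
def relEntropy (ρ σ : Matrix X X ℂ) : EReal :=
  if ∀ v : X → ℂ, σ *ᵥ v = 0 → ρ *ᵥ v = 0 then
    (((ρ * (opLog ρ - opLog σ)).trace.re : ℝ) : EReal)
  else ⊤

/-- The minimal observational entropy `S_χ(ρ)` over a set `χ` of POVMs. -/
def minObsEntropy (χ : Set (POVM X)) (ρ : Matrix X X ℂ) : EReal :=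
  ⨅ M ∈ χ, ((M.obsEntropy ρ : ℝ) : EReal)

/-- The entropy gap `E_χ(ρ) = S_χ(ρ) - S(ρ)`. -/
def gap (χ : Set (POVM X)) (ρ : Matrix X X ℂ) : EReal :=
  minObsEntropy χ ρ - ((vonNeumannEntropy ρ : ℝ) : EReal)

/-- The relative entropy distance `inf_{σ ∈ Ω} D(ρ‖σ)` to a set `Ω` of states. -/
def relEntropyDist (Ω : Set (Matrix X X ℂ)) (ρ : Matrix X X ℂ) : EReal :=
  ⨅ σ ∈ Ω, relEntropy ρ σ

end General

/-! ### Multipartite systems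

The `k`-th subsystem is `ℂ^(d k)`; the joint system is their tensor product. -/

section Multipartite

variable {n : ℕ}

/-- The index set of the product basis of `ℂ^(d 0) ⊗ ⋯ ⊗ ℂ^(d (n-1))`. -/
abbrev Idx (d : Fin n → ℕ) : Type := (k : Fin n) → Fin (d k)

variable {d : Fin n → ℕ}

/-- The product vector `ψ_1 ⊗ ⋯ ⊗ ψ_n`. -/
def tensorKet (ψ : (k : Fin n) → EuclideanSpace ℂ (Fin (d k))) : Idx d → ℂ :=
  fun x => ∏ k, ψ k (x k)

/-- The tensor product `A_1 ⊗ ⋯ ⊗ A_n` of operators on the subsystems. -/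
def tensorOp (A : (k : Fin n) → Matrix (Fin (d k)) (Fin (d k)) ℂ) : Matrix (Idx d) (Idx d) ℂ :=
  Matrix.of fun x y => ∏ k, A k (x k) (y k)

theorem tensorOp_mul (A B : (k : Fin n) → Matrix (Fin (d k)) (Fin (d k)) ℂ) :
    tensorOp A * tensorOp B = tensorOp fun k => A k * B k := by
  ext x y
  simp only [tensorOp, Matrix.mul_apply, Matrix.of_apply]
  rw [Finset.prod_univ_sum, Fintype.piFinset_univ]
  exact Finset.sum_congr rfl fun z _ => Finset.prod_mul_distrib.symm

theorem tensorOp_conjTranspose (A : (k : Fin n) → Matrix (Fin (d k)) (Fin (d k)) ℂ) :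
    (tensorOp A)ᴴ = tensorOp fun k => (A k)ᴴ := by
  ext x y
  simp [tensorOp, Matrix.conjTranspose_apply]

theorem tensorOp_one :
    tensorOp (fun k => (1 : Matrix (Fin (d k)) (Fin (d k)) ℂ)) = 1 := by
  ext x y
  simp only [tensorOp, Matrix.of_apply, Matrix.one_apply]
  by_cases h : x = y
  · subst h
    simp
  · obtain ⟨k, hk⟩ := Function.ne_iff.mp h
    rw [if_neg h]
    exact Finset.prod_eq_zero (Finset.mem_univ k) (if_neg hk)

open scoped MatrixOrder Matrix.Norms.L2Operator in
theorem tensorOp_posSemidef {A : (k : Fin n) → Matrix (Fin (d k)) (Fin (d k)) ℂ}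
    (hA : ∀ k, (A k).PosSemidef) : (tensorOp A).PosSemidef := by
  have h : ∀ k, ∃ B : Matrix (Fin (d k)) (Fin (d k)) ℂ, A k = Bᴴ * B := fun k =>
    CStarAlgebra.nonneg_iff_eq_star_mul_self.mp (hA k).nonneg
  choose B hB using h
  have : tensorOp A = (tensorOp B)ᴴ * tensorOp B := by
    rw [tensorOp_conjTranspose, tensorOp_mul]
    exact congrArg tensorOp (funext hB)
  rw [this]
  exact Matrix.posSemidef_conjTranspose_mul_self _

/-- The tensor product measurement `M_1 ⊗ ⋯ ⊗ M_n`. -/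
def tensorPOVM (M : (k : Fin n) → POVM (Fin (d k))) : POVM (Idx d) where
  Outcome := (k : Fin n) → (M k).Outcome
  fintypeOutcome := by classical exact inferInstance
  op i := tensorOp fun k => (M k).op (i k)
  posSemidef i := tensorOp_posSemidef fun k => (M k).posSemidef (i k)
  sum_op := by
    classical
    rw [← tensorOp_one]
    ext x y
    simp only [Matrix.sum_apply, tensorOp, Matrix.of_apply]
    have h : ∀ k, (1 : Matrix (Fin (d k)) (Fin (d k)) ℂ) (x k) (y k)
        = ∑ i, (M k).op i (x k) (y k) := fun k => by
      rw [← (M k).sum_op, Matrix.sum_apply]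
    simp only [h]
    rw [Finset.prod_univ_sum, Fintype.piFinset_univ]

/-- The partial transpose on the subsystems in `S`. -/
def partialTranspose (S : Finset (Fin n)) (A : Matrix (Idx d) (Idx d) ℂ) :
    Matrix (Idx d) (Idx d) ℂ :=
  Matrix.of fun x y => A (S.piecewise y x) (S.piecewise x y)

/-- Finite sums of tensor products of positive semidefinite operators. -/
def IsSeparableOp (A : Matrix (Idx d) (Idx d) ℂ) : Prop :=
  ∃ (m : ℕ) (B : Fin m → (k : Fin n) → Matrix (Fin (d k)) (Fin (d k)) ℂ),
    (∀ j k, (B j k).PosSemidef) ∧ A = ∑ j, tensorOp (B j)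

/-- Operators whose partial transpose is positive for every bipartition of the parties
(`S = ∅` gives positivity of the operator itself). -/
def IsPPTOp (A : Matrix (Idx d) (Idx d) ℂ) : Prop :=
  ∀ S : Finset (Fin n), (partialTranspose S A).PosSemidef

variable (d)

/-- Local projective measurements. -/
def LOstar : Set (POVM (Idx d)) :=
  {M | ∃ P : (k : Fin n) → POVM (Fin (d k)), (∀ k, (P k).IsProjective) ∧ M = tensorPOVM P}

/-- Separable measurements. -/
def SEP : Set (POVM (Idx d)) :=
  {M | ∀ i, IsSeparableOp (M.op i)}

/-- Measurements with positive partial transpose. -/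
def PPT : Set (POVM (Idx d)) :=
  {M | ∀ i, IsPPTOp (M.op i)}

/-- Classically correlated states: diagonal in a product of local orthonormal bases. -/
def ccStates : Set (Matrix (Idx d) (Idx d) ℂ) :=
  {σ | ∃ (ψ : (k : Fin n) → OrthonormalBasis (Fin (d k)) ℂ (EuclideanSpace ℂ (Fin (d k))))
      (p : Idx d → ℝ), (∀ i, 0 ≤ p i) ∧ ∑ i, p i = 1 ∧
      σ = ∑ i, (p i : ℂ) • ketbra (tensorKet fun k => ψ k (i k))}

/-- Separable states: finite convex combinations of product states. -/
def sepStates : Set (Matrix (Idx d) (Idx d) ℂ) :=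
  {σ | ∃ (m : ℕ) (p : Fin m → ℝ) (τ : Fin m → (k : Fin n) → Matrix (Fin (d k)) (Fin (d k)) ℂ),
      (∀ j, 0 ≤ p j) ∧ ∑ j, p j = 1 ∧ (∀ j k, IsState (τ j k)) ∧
      σ = ∑ j, (p j : ℂ) • tensorOp (τ j)}

/-- States with positive partial transpose. -/
def pptStates : Set (Matrix (Idx d) (Idx d) ℂ) :=
  {σ | IsState σ ∧ IsPPTOp σ}

variable {d}

/-- The relative entropy of quantumness. -/
def relEntQuantumness (ρ : Matrix (Idx d) (Idx d) ℂ) : EReal :=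
  relEntropyDist (ccStates d) ρ

/-- The relative entropy of entanglement. -/
def relEntEntanglement (ρ : Matrix (Idx d) (Idx d) ℂ) : EReal :=
  relEntropyDist (sepStates d) ρ

/-- The PPT relative entropy of entanglement. -/
def relEntEntanglementPPT (ρ : Matrix (Idx d) (Idx d) ℂ) : EReal :=
  relEntropyDist (pptStates d) ρ

end Multipartite

end EntropyGap

end

namespace EntropyGap

open Matrix
open scoped ComplexOrder

/-! ### Positivity of traces of products. -/

section General

variable {X : Type} [Fintype X] [DecidableEq X]

/-! All three lower bounds come from the coarse-grained state `σ = ∑ (p_i / V_i) M_i`. Operator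
concavity of the logarithm gives `∑ p_i log (p_i / V_i) ≤ Tr ρ log σ` (`sum_prob_mul_log_le`), that
is, `D(ρ‖σ) ≤ S_M(ρ) - S(ρ)`. It remains to see that `σ` lies in the matching class of states, which
holds because `σ` is a nonnegative combination of the `M_i`; in the projective case it is also
diagonal in local eigenbases.

Concavity is reduced to operator convexity of the inverse (`posSemidef_sum_inv_smul_sub`), applied
to all shifts by `t > 0`; the scalar lemma `sum_mul_log_le_sum_mul_log` turns the resolvent
inequalities into one for logarithms.

Conversely, if `σ` is diagonal in a product basis, measuring `ρ` in that basis costs at most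
`D(ρ‖σ)` by Gibbs' inequality (`neg_sum_diagWeight_mul_log_le`), so the first bound is an equality.
-/

open scoped MatrixOrder Matrix.Norms.L2Operator in
theorem exists_eq_conjTranspose_mul_self {A : Matrix X X ℂ} (hA : A.PosSemidef) :
    ∃ B : Matrix X X ℂ, A = Bᴴ * B :=
  CStarAlgebra.nonneg_iff_eq_star_mul_self.mp hA.nonneg

theorem trace_mul_nonneg {A B : Matrix X X ℂ} (hA : A.PosSemidef) (hB : B.PosSemidef) :
    0 ≤ (A * B).trace := by
  obtain ⟨C, rfl⟩ := exists_eq_conjTranspose_mul_self hB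
  rw [← Matrix.mul_assoc, Matrix.trace_mul_comm, ← Matrix.mul_assoc]
  exact (hA.mul_mul_conjTranspose_same C).trace_nonneg

/-- With `A = Dᴴ D` and `B = Cᴴ C` the trace is the squared Hilbert–Schmidt norm of `D Cᴴ`. This
makes `ρ` annihilate outcomes of probability zero. -/
theorem mul_eq_zero_of_trace_re_eq_zero {A B : Matrix X X ℂ} (hA : A.PosSemidef)
    (hB : B.PosSemidef) (h : (A * B).trace.re = 0) : A * B = 0 := by
  have h0 : (A * B).trace = 0 :=
    Complex.ext h (Complex.le_def.mp (trace_mul_nonneg hA hB)).2.symm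
  obtain ⟨C, rfl⟩ := exists_eq_conjTranspose_mul_self hB
  rw [← Matrix.mul_assoc, Matrix.trace_mul_comm, ← Matrix.mul_assoc,
    (hA.mul_mul_conjTranspose_same C).trace_eq_zero_iff] at h0
  obtain ⟨D, rfl⟩ := exists_eq_conjTranspose_mul_self hA
  have h1 : (D * Cᴴ)ᴴ * (D * Cᴴ) = 0 := by
    rw [← h0]
    simp [Matrix.mul_assoc]
  rw [Matrix.conjTranspose_mul_self_eq_zero] at h1
  rw [Matrix.mul_assoc, ← Matrix.mul_assoc D, h1]
  simp

/-! ### Operators with a given eigenbasis -/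

/-- The operator with real eigenvalues `p` and eigenvectors the columns of `U`. -/
def unitaryDiag (U : Matrix X X ℂ) (p : X → ℝ) : Matrix X X ℂ :=
  U * diagonal (fun i => (p i : ℂ)) * Uᴴ

/-- The diagonal of `ρ` in the basis given by the columns of `U`. -/
def diagWeight (U ρ : Matrix X X ℂ) (k : X) : ℝ :=
  ((Uᴴ * ρ * U) k k).re

theorem unitaryDiag_mul {U : Matrix X X ℂ} (hU : Uᴴ * U = 1) (p q : X → ℝ) :
    unitaryDiag U p * unitaryDiag U q = unitaryDiag U (fun i => p i * q i) := by
  have h : unitaryDiag U p * unitaryDiag U q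
      = U * diagonal (fun i => (p i : ℂ)) * (Uᴴ * U) * diagonal (fun i => (q i : ℂ)) * Uᴴ := by
    simp only [unitaryDiag, Matrix.mul_assoc]
  rw [h, hU, Matrix.mul_one, Matrix.mul_assoc U, diagonal_mul_diagonal]
  simp [unitaryDiag]

theorem unitaryDiag_one {U : Matrix X X ℂ} (hU : Uᴴ * U = 1) :
    unitaryDiag U (fun _ => 1) = 1 := by
  simp [unitaryDiag, mul_eq_one_comm.mp hU]

theorem unitaryDiag_add_const {U : Matrix X X ℂ} (hU : Uᴴ * U = 1) (p : X → ℝ) (t : ℝ) :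
    unitaryDiag U (fun i => p i + t) = unitaryDiag U p + (t : ℂ) • 1 := by
  have h : diagonal (fun i => ((p i + t : ℝ) : ℂ))
      = diagonal (fun i => (p i : ℂ)) + (t : ℂ) • (1 : Matrix X X ℂ) := by
    ext i j
    by_cases hij : i = j <;> simp [hij]
  rw [unitaryDiag, h, Matrix.mul_add, Matrix.add_mul]
  simp [unitaryDiag, mul_eq_one_comm.mp hU]

theorem unitaryDiag_isHermitian (U : Matrix X X ℂ) (p : X → ℝ) :
    (unitaryDiag U p).IsHermitian := by
  have h : (diagonal (fun i => (p i : ℂ)))ᴴ = diagonal (fun i => (p i : ℂ)) := by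
    rw [diagonal_conjTranspose]
    congr 1
    ext i
    simp
  simp only [Matrix.IsHermitian, unitaryDiag, conjTranspose_mul, conjTranspose_conjTranspose, h,
    Matrix.mul_assoc]

theorem exists_eq_unitaryDiag {A : Matrix X X ℂ} (hA : A.PosSemidef) :
    ∃ (U : Matrix X X ℂ) (p : X → ℝ), Uᴴ * U = 1 ∧ (∀ i, 0 ≤ p i) ∧ A = unitaryDiag U p :=
  ⟨(hA.isHermitian.eigenvectorUnitary : Matrix X X ℂ), hA.isHermitian.eigenvalues,
    Unitary.coe_star_mul_self hA.isHermitian.eigenvectorUnitary, hA.eigenvalues_nonneg,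
    hA.isHermitian.spectral_theorem⟩

/-- The functional calculus is computed in a chosen eigenbasis `V`, possibly different from `U`. The
matrix `Vᴴ U` intertwines the two diagonal forms, so its nonzero entries link only equal
eigenvalues; hence it also intertwines their logarithms. -/
theorem opLog_unitaryDiag {U : Matrix X X ℂ} (hU : Uᴴ * U = 1) (p : X → ℝ) :
    opLog (unitaryDiag U p) = unitaryDiag U (fun i => Real.log (p i)) := by
  have hA := unitaryDiag_isHermitian U p
  obtain ⟨V, μ, hV, hspec, hlog⟩ : ∃ (V : Matrix X X ℂ) (μ : X → ℝ), Vᴴ * V = 1 ∧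
      unitaryDiag U p = unitaryDiag V μ ∧
      opLog (unitaryDiag U p) = unitaryDiag V (fun i => Real.log (μ i)) :=
    ⟨(hA.eigenvectorUnitary : Matrix X X ℂ), hA.eigenvalues,
      Unitary.coe_star_mul_self hA.eigenvectorUnitary, hA.spectral_theorem, hA.cfc_eq Real.log⟩
  have hU' := mul_eq_one_comm.mp hU
  have hV' := mul_eq_one_comm.mp hV
  have key : ∀ q r : X → ℝ, unitaryDiag U q = unitaryDiag V r ↔
      diagonal (fun i => (r i : ℂ)) * (Vᴴ * U) = (Vᴴ * U) * diagonal (fun i => (q i : ℂ)) := by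
    intro q r
    constructor
    · intro h
      have h2 : Vᴴ * unitaryDiag V r * U = Vᴴ * unitaryDiag U q * U := by rw [h]
      calc _ = (Vᴴ * V) * diagonal (fun i => (r i : ℂ)) * (Vᴴ * U) := by rw [hV, Matrix.one_mul]
        _ = Vᴴ * unitaryDiag V r * U := by simp only [unitaryDiag, Matrix.mul_assoc]
        _ = Vᴴ * unitaryDiag U q * U := h2
        _ = (Vᴴ * U) * diagonal (fun i => (q i : ℂ)) * (Uᴴ * U) := by
          simp only [unitaryDiag, Matrix.mul_assoc]
        _ = _ := by rw [hU, Matrix.mul_one]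
    · intro h
      calc _ = (V * Vᴴ) * U * diagonal (fun i => (q i : ℂ)) * Uᴴ := by
            rw [hV', Matrix.one_mul, unitaryDiag]
        _ = V * ((Vᴴ * U) * diagonal (fun i => (q i : ℂ))) * Uᴴ := by
          simp only [Matrix.mul_assoc]
        _ = V * diagonal (fun i => (r i : ℂ)) * Vᴴ * (U * Uᴴ) := by
          rw [← h]
          simp only [Matrix.mul_assoc]
        _ = _ := by rw [hU', Matrix.mul_one, unitaryDiag]
  have h1 := (key p μ).mp hspec
  rw [hlog]
  refine ((key _ _).mpr ?_).symm
  ext i j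
  have h2 := congrFun (congrFun h1 i) j
  rw [diagonal_mul, mul_diagonal] at h2 ⊢
  by_cases h0 : (Vᴴ * U) i j = 0
  · simp [h0]
  · rw [mul_comm] at h2
    have h3 : μ i = p j := by exact_mod_cast mul_left_cancel₀ h0 h2
    rw [h3, mul_comm]

theorem trace_mul_unitaryDiag (U ρ : Matrix X X ℂ) (p : X → ℝ) :
    (ρ * unitaryDiag U p).trace.re = ∑ k, diagWeight U ρ k * p k := by
  have h : (ρ * unitaryDiag U p).trace = ((Uᴴ * ρ * U) * diagonal (fun i => (p i : ℂ))).trace := by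
    rw [unitaryDiag, ← Matrix.mul_assoc, Matrix.trace_mul_comm]
    simp only [Matrix.mul_assoc]
  rw [h, Matrix.trace, Complex.re_sum]
  refine Finset.sum_congr rfl fun k _ => ?_
  rw [diag_apply, mul_diagonal, Complex.re_mul_ofReal, diagWeight]

theorem sum_diagWeight {U ρ : Matrix X X ℂ} (hU : Uᴴ * U = 1) :
    ∑ k, diagWeight U ρ k = ρ.trace.re := by
  have h := trace_mul_unitaryDiag U ρ fun _ => 1
  rw [unitaryDiag_one hU] at h
  simpa using h.symm

theorem diagWeight_nonneg {Y : Type} [Fintype Y] (U : Matrix Y Y ℂ) {ρ : Matrix Y Y ℂ}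
    (hρ : ρ.PosSemidef) (k : Y) :
    0 ≤ diagWeight U ρ k :=
  (Complex.le_def.mp ((hρ.conjTranspose_mul_mul_same U).diag_nonneg (i := k))).1

theorem diagWeight_eq_zero {U ρ : Matrix X X ℂ} (hU : Uᴴ * U = 1) {p : X → ℝ}
    (hker : ∀ v : X → ℂ, unitaryDiag U p *ᵥ v = 0 → ρ *ᵥ v = 0) {k : X} (hk : p k = 0) :
    diagWeight U ρ k = 0 := by
  have h : ρ *ᵥ (U *ᵥ Pi.single k 1) = 0 := by
    apply hker
    rw [unitaryDiag, Matrix.mulVec_mulVec, Matrix.mul_assoc, hU, Matrix.mul_one,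
      ← Matrix.mulVec_mulVec, Matrix.diagonal_mulVec_single, hk]
    simp
  have h2 : (Uᴴ * ρ * U) *ᵥ Pi.single k 1 = 0 := by
    rw [← Matrix.mulVec_mulVec, ← Matrix.mulVec_mulVec, h, Matrix.mulVec_zero]
  have h3 := congrFun h2 k
  rw [Matrix.mulVec_single_one] at h3
  rw [diagWeight, show (Uᴴ * ρ * U) k k = 0 from h3, Complex.zero_re]

/-! ### Logarithmic comparison of weighted averages -/

-- The difference `F t` of the two sides with arguments shifted by `t` has nonnegative derivative by
-- `h` and tends to `0` at infinity, so `F ≤ 0`; let `t → 0+`. This replaces the integral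
-- representation of the logarithm.
open Filter Topology in
theorem sum_mul_log_le_sum_mul_log {ι κ : Type} [Fintype ι] [Fintype κ]
    {w c : ι → ℝ} {a l : κ → ℝ} (hc : ∀ i, 0 ≤ c i) (hl : ∀ k, 0 ≤ l k)
    (hsum : ∑ k, a k = ∑ i, w i) (hc0 : ∀ i, c i = 0 → w i = 0) (hl0 : ∀ k, l k = 0 → a k = 0)
    (h : ∀ t > 0, ∑ k, a k * (l k + t)⁻¹ ≤ ∑ i, w i * (c i + t)⁻¹) :
    ∑ i, w i * Real.log (c i) ≤ ∑ k, a k * Real.log (l k) := by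
  set F : ℝ → ℝ := fun t =>
    ∑ i, w i * Real.log (c i + t) - ∑ k, a k * Real.log (l k + t) with hF
  have hderiv : ∀ t > 0, HasDerivAt F
      (∑ i, w i * (c i + t)⁻¹ - ∑ k, a k * (l k + t)⁻¹) t := by
    intro t ht
    refine HasDerivAt.sub ?_ ?_
    · refine HasDerivAt.fun_sum fun i _ => HasDerivAt.const_mul _ ?_
      simpa using ((hasDerivAt_id t).const_add (c i)).log (by have := hc i; simp; linarith)
    · refine HasDerivAt.fun_sum fun i _ => HasDerivAt.const_mul _ ?_
      simpa using ((hasDerivAt_id t).const_add (l i)).log (by have := hl i; simp; linarith)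
  have hmono : MonotoneOn F (Set.Ioi 0) := by
    refine monotoneOn_of_deriv_nonneg (convex_Ioi 0)
      (fun t ht => (hderiv t ht).continuousAt.continuousWithinAt) ?_ ?_
    · rw [interior_Ioi]
      exact fun t ht => (hderiv t ht).differentiableAt.differentiableWithinAt
    · rw [interior_Ioi]
      intro t ht
      rw [(hderiv t ht).deriv]
      linarith [h t ht]
  have hlim1 : ∀ x : ℝ, 0 ≤ x → Tendsto (fun t => Real.log (x + t) - Real.log t) atTop (𝓝 0) := by
    intro x hx
    have h1 : Tendsto (fun t : ℝ => Real.log (x * t⁻¹ + 1)) atTop (𝓝 0) := by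
      have h2 : Tendsto (fun t : ℝ => x * t⁻¹ + 1) atTop (𝓝 1) := by
        simpa using (tendsto_inv_atTop_zero.const_mul x).add_const 1
      simpa using h2.log one_ne_zero
    refine h1.congr' ?_
    filter_upwards [eventually_gt_atTop 0] with t ht
    rw [← Real.log_div (by linarith) ht.ne']
    congr 1
    field_simp
  have hlim : Tendsto F atTop (𝓝 0) := by
    -- Equal total weights allow `log t` to be subtracted in both sums at no cost.
    have h1 : F = fun t => ∑ i, w i * (Real.log (c i + t) - Real.log t)
        - ∑ k, a k * (Real.log (l k + t) - Real.log t) := by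
      ext t
      simp only [hF, mul_sub, Finset.sum_sub_distrib, ← Finset.sum_mul, hsum]
      ring
    rw [h1]
    have h2 : Tendsto (fun t => ∑ i, w i * (Real.log (c i + t) - Real.log t)) atTop (𝓝 0) := by
      simpa using tendsto_finsetSum Finset.univ
        fun i _ => (hlim1 (c i) (hc i)).const_mul (w i)
    have h3 : Tendsto (fun t => ∑ k, a k * (Real.log (l k + t) - Real.log t)) atTop (𝓝 0) := by
      simpa using tendsto_finsetSum Finset.univ
        fun i _ => (hlim1 (l i) (hl i)).const_mul (a i)
    simpa using h2.sub h3
  have hneg : ∀ t > 0, F t ≤ 0 := by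
    intro t ht
    refine ge_of_tendsto hlim ?_
    filter_upwards [eventually_ge_atTop t] with s hs
    exact hmono ht (lt_of_lt_of_le ht hs) hs
  -- Where the logarithm diverges its weight vanishes, so the term is constantly zero.
  have hcont : ∀ x y : ℝ, 0 ≤ x → (x = 0 → y = 0) →
      Tendsto (fun t => y * Real.log (x + t)) (𝓝[>] 0) (𝓝 (y * Real.log x)) := by
    intro x y _ hxy
    by_cases hx : x = 0
    · simp [hxy hx]
    · have h1 : Tendsto (fun t : ℝ => x + t) (𝓝[>] 0) (𝓝 x) := by
        have h2 : Tendsto (fun t : ℝ => x + t) (𝓝 0) (𝓝 (x + 0)) :=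
          (continuous_const.add continuous_id).tendsto 0
        rw [add_zero] at h2
        exact h2.mono_left nhdsWithin_le_nhds
      exact (h1.log hx).const_mul y
  have hzero : Tendsto F (𝓝[>] 0)
      (𝓝 (∑ i, w i * Real.log (c i) - ∑ k, a k * Real.log (l k))) :=
    (tendsto_finsetSum _ fun i _ => hcont _ _ (hc i) (hc0 i)).sub
      (tendsto_finsetSum _ fun k _ => hcont _ _ (hl k) (hl0 k))
  have := le_of_tendsto hzero (eventually_nhdsWithin_of_forall fun t ht => hneg t ht)
  linarith

/-- Gibbs' inequality. -/
theorem sum_mul_log_le_sum_mul_log_self {ι : Type} [Fintype ι] {p q : ι → ℝ}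
    (hp : ∀ i, 0 ≤ p i) (hq : ∀ i, 0 ≤ q i) (hsum : ∑ i, p i = ∑ i, q i)
    (h0 : ∀ i, p i = 0 → q i = 0) :
    ∑ i, q i * Real.log (p i) ≤ ∑ i, q i * Real.log (q i) := by
  have h : ∀ i, q i * Real.log (p i) - q i * Real.log (q i) ≤ p i - q i := by
    intro i
    rcases (hq i).eq_or_lt with hqi | hqi
    · simp [← hqi, hp i]
    · have hpi : 0 < p i := (hp i).lt_of_ne fun h => hqi.ne' (h0 i h.symm)
      have h1 := Real.log_le_sub_one_of_pos (div_pos hpi hqi)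
      rw [Real.log_div hpi.ne' hqi.ne'] at h1
      have h2 := mul_le_mul_of_nonneg_left h1 hqi.le
      have h3 : q i * (p i / q i - 1) = p i - q i := by field_simp
      linarith
  have h1 := Finset.sum_le_sum fun i (_ : i ∈ Finset.univ) => h i
  rw [Finset.sum_sub_distrib, Finset.sum_sub_distrib] at h1
  linarith

theorem ofReal_trace_re {Y : Type} [Fintype Y] {A : Matrix Y Y ℂ} (hA : A.PosSemidef) :
    ((A.trace.re : ℝ) : ℂ) = A.trace :=
  Complex.ext (by simp) (by simpa using (Complex.le_def.mp hA.trace_nonneg).2)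

theorem posSemidef_sum_smul {Y ι : Type} [Fintype ι] {c : ι → ℝ} (hc : ∀ i, 0 ≤ c i)
    {A : ι → Matrix Y Y ℂ} (hA : ∀ i, (A i).PosSemidef) :
    (∑ i, (c i : ℂ) • A i).PosSemidef :=
  Matrix.posSemidef_sum _ fun i _ => (hA i).smul (by exact_mod_cast hc i)

/-! ### The coarse-grained state and the lower bound on the gap. -/

namespace POVM

variable (M : POVM X) {ρ : Matrix X X ℂ}

theorem volume_nonneg (i : M.Outcome) : 0 ≤ M.volume i :=
  (Complex.le_def.mp (M.posSemidef i).trace_nonneg).1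

theorem prob_nonneg (hρ : ρ.PosSemidef) (i : M.Outcome) : 0 ≤ M.prob ρ i :=
  (Complex.le_def.mp (trace_mul_nonneg hρ (M.posSemidef i))).1

theorem sum_prob : ∑ i, M.prob ρ i = ρ.trace.re := by
  simp only [prob]
  rw [← Complex.re_sum, ← Matrix.trace_sum, ← Matrix.mul_sum, M.sum_op, Matrix.mul_one]

theorem op_eq_zero_of_volume_eq_zero {i : M.Outcome} (h : M.volume i = 0) : M.op i = 0 := by
  rw [← (M.posSemidef i).trace_eq_zero_iff, ← ofReal_trace_re (M.posSemidef i)]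
  exact_mod_cast h

theorem prob_eq_zero_of_volume_eq_zero {i : M.Outcome} (h : M.volume i = 0) :
    M.prob ρ i = 0 := by
  simp [prob, M.op_eq_zero_of_volume_eq_zero h]

theorem prob_eq_zero_of_div_eq_zero {i : M.Outcome} (h : M.prob ρ i / M.volume i = 0) :
    M.prob ρ i = 0 :=
  (div_eq_zero_iff.mp h).elim id M.prob_eq_zero_of_volume_eq_zero

/-- The coarse-grained state `∑ (p_i / V_i) M_i`. -/
noncomputable def coarse (ρ : Matrix X X ℂ) : Matrix X X ℂ :=
  ∑ i, ((M.prob ρ i / M.volume i : ℝ) : ℂ) • M.op i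

/-- Each term has trace `p_i`, also when `V_i = 0`, since then `M_i = 0` and `p_i = 0`. -/
theorem coarse_isState (hρ : IsState ρ) : IsState (M.coarse ρ) := by
  refine ⟨posSemidef_sum_smul (fun i => div_nonneg (M.prob_nonneg hρ.1 i) (M.volume_nonneg i))
    M.posSemidef, ?_⟩
  have h : ∀ i, (((M.prob ρ i / M.volume i : ℝ) : ℂ) • M.op i).trace = (M.prob ρ i : ℂ) := by
    intro i
    rw [Matrix.trace_smul, ← ofReal_trace_re (M.posSemidef i), smul_eq_mul, ← Complex.ofReal_mul]
    congr 1
    change M.prob ρ i / M.volume i * M.volume i = M.prob ρ i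
    by_cases h0 : M.volume i = 0
    · simp [M.prob_eq_zero_of_volume_eq_zero h0]
    · exact div_mul_cancel₀ _ h0
  rw [coarse, Matrix.trace_sum, Finset.sum_congr rfl fun i _ => h i, ← Complex.ofReal_sum,
    M.sum_prob, hρ.2]
  simp

/-- Operator Jensen inequality for the inverse:
`(∑ b_i M_i)⁻¹ ≤ ∑ b_i⁻¹ M_i` for positive coefficients `b_i`. -/
theorem posSemidef_sum_inv_smul_sub {b : M.Outcome → ℝ} (hb : ∀ i, 0 < b i) {R : Matrix X X ℂ}
    (hR : R.IsHermitian) (hSR : (∑ i, (b i : ℂ) • M.op i) * R = 1) :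
    (∑ i, ((b i)⁻¹ : ℂ) • M.op i - R).PosSemidef := by
  -- Completing the square: after summation the cross terms give `-2R`, and the last term gives `R`
  -- because `R` inverts `∑ b_i M_i`.
  have h : ∀ i, ((b i)⁻¹ : ℂ) • ((1 - (b i : ℂ) • R)ᴴ * M.op i * (1 - (b i : ℂ) • R))
      = ((b i)⁻¹ : ℂ) • M.op i - M.op i * R - R * M.op i + R * ((b i : ℂ) • M.op i) * R := by
    intro i
    have hbi : (b i : ℂ) ≠ 0 := by exact_mod_cast (hb i).ne'
    have hR' : (1 - (b i : ℂ) • R)ᴴ = 1 - (b i : ℂ) • R := by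
      rw [conjTranspose_sub, conjTranspose_smul, hR.eq]
      simp
    rw [hR']
    simp only [sub_mul, mul_sub, Matrix.one_mul, Matrix.mul_one, Matrix.smul_mul, Matrix.mul_smul,
      smul_sub, smul_smul, inv_mul_cancel₀ hbi, one_smul]
    rw [← mul_assoc, inv_mul_cancel₀ hbi, one_mul]
    abel
  have hsum : ∑ i, ((b i)⁻¹ : ℂ) • M.op i - R
      = ∑ i, ((b i)⁻¹ : ℂ) • ((1 - (b i : ℂ) • R)ᴴ * M.op i * (1 - (b i : ℂ) • R)) := by
    rw [Finset.sum_congr rfl fun i _ => h i]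
    simp only [Finset.sum_add_distrib, Finset.sum_sub_distrib]
    rw [← Matrix.sum_mul, ← Matrix.mul_sum, ← Matrix.sum_mul, ← Matrix.mul_sum, M.sum_op,
      Matrix.mul_assoc, hSR]
    simp
  rw [hsum]
  have := posSemidef_sum_smul (c := fun i => (b i)⁻¹) (fun i => (inv_pos.mpr (hb i)).le)
    fun i => (M.posSemidef i).conjTranspose_mul_mul_same (1 - (b i : ℂ) • R)
  simpa using this

/-- Since `∑ M_i = 1`, shifting every coefficient by `t` shifts every eigenvalue by `t`. Operator
Jensen for the shifted coefficients is then traced against `ρ`. -/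
theorem sum_diagWeight_mul_inv_le (hρ : ρ.PosSemidef) {U : Matrix X X ℂ} (hU : Uᴴ * U = 1)
    {l : X → ℝ} (hl : ∀ k, 0 ≤ l k) {c : M.Outcome → ℝ} (hc : ∀ i, 0 ≤ c i)
    (h : ∑ i, (c i : ℂ) • M.op i = unitaryDiag U l) {t : ℝ} (ht : 0 < t) :
    ∑ k, diagWeight U ρ k * (l k + t)⁻¹ ≤ ∑ i, M.prob ρ i * (c i + t)⁻¹ := by
  have hS : ∑ i, ((c i + t : ℝ) : ℂ) • M.op i = unitaryDiag U fun k => l k + t := by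
    rw [unitaryDiag_add_const hU, ← h, ← M.sum_op, Finset.smul_sum, ← Finset.sum_add_distrib]
    simp [add_smul]
  have hSR : (∑ i, ((c i + t : ℝ) : ℂ) • M.op i) * unitaryDiag U (fun k => (l k + t)⁻¹) = 1 := by
    rw [hS, unitaryDiag_mul hU, ← unitaryDiag_one hU]
    congr 1
    ext k
    exact mul_inv_cancel₀ (by have := hl k; linarith)
  have hpsd := M.posSemidef_sum_inv_smul_sub (b := fun i => c i + t)
    (fun i => by have := hc i; linarith) (unitaryDiag_isHermitian U _) hSR
  have h1 := (Complex.le_def.mp (trace_mul_nonneg hρ hpsd)).1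
  rw [Matrix.mul_sub, Matrix.trace_sub, Complex.sub_re, trace_mul_unitaryDiag, Matrix.mul_sum,
    Matrix.trace_sum, Complex.re_sum] at h1
  have h2 : ∀ i, (ρ * (((c i + t : ℝ) : ℂ)⁻¹ • M.op i)).trace.re
      = M.prob ρ i * (c i + t)⁻¹ := by
    intro i
    rw [Matrix.mul_smul, Matrix.trace_smul, smul_eq_mul, ← Complex.ofReal_inv,
      Complex.re_ofReal_mul, prob, mul_comm]
  rw [Finset.sum_congr rfl fun i _ => h2 i] at h1
  simpa using h1

/-- For every `i` one has `ρ M_i v = 0`: if `p_i = 0` then `ρ M_i = 0`; otherwise `M_i` has a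
positive coefficient in the coarse-grained state, so `M_i v = 0`. Summing over `i` gives `ρ v`. -/
theorem mulVec_eq_zero_of_coarse_mulVec_eq_zero (hρ : ρ.PosSemidef) {v : X → ℂ}
    (hv : M.coarse ρ *ᵥ v = 0) : ρ *ᵥ v = 0 := by
  have hop : ∀ i, ρ *ᵥ (M.op i *ᵥ v) = 0 := by
    intro i
    by_cases hp : M.prob ρ i = 0
    · rw [Matrix.mulVec_mulVec, mul_eq_zero_of_trace_re_eq_zero hρ (M.posSemidef i) hp,
        Matrix.zero_mulVec]
    · have hsum : ∑ j, star v ⬝ᵥ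
          ((((M.prob ρ j / M.volume j : ℝ) : ℂ) • M.op j) *ᵥ v) = 0 := by
        rw [← dotProduct_sum, ← Matrix.sum_mulVec]
        change star v ⬝ᵥ (M.coarse ρ *ᵥ v) = 0
        rw [hv, dotProduct_zero]
      have hpsd : ∀ j, (((M.prob ρ j / M.volume j : ℝ) : ℂ) • M.op j).PosSemidef := fun j =>
        (M.posSemidef j).smul
          (by exact_mod_cast div_nonneg (M.prob_nonneg hρ j) (M.volume_nonneg j))
      have hi := (Finset.sum_eq_zero_iff_of_nonneg
        fun j _ => (hpsd j).dotProduct_mulVec_nonneg v).mp hsum i (Finset.mem_univ i)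
      rw [(hpsd i).dotProduct_mulVec_zero_iff, Matrix.smul_mulVec, smul_eq_zero] at hi
      rcases hi with hi | hi
      · exact absurd (M.prob_eq_zero_of_div_eq_zero (by exact_mod_cast hi)) hp
      · rw [hi, Matrix.mulVec_zero]
  calc ρ *ᵥ v = ρ *ᵥ ((∑ i, M.op i) *ᵥ v) := by rw [M.sum_op, Matrix.one_mulVec]
    _ = ∑ i, ρ *ᵥ (M.op i *ᵥ v) := by rw [Matrix.sum_mulVec, Matrix.mulVec_sum]
    _ = 0 := Finset.sum_eq_zero fun i _ => hop i

theorem sum_prob_mul_log_le (hρ : ρ.PosSemidef) :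
    ∑ i, M.prob ρ i * Real.log (M.prob ρ i / M.volume i)
      ≤ (ρ * opLog (M.coarse ρ)).trace.re := by
  have hc : ∀ i, 0 ≤ M.prob ρ i / M.volume i := fun i =>
    div_nonneg (M.prob_nonneg hρ i) (M.volume_nonneg i)
  obtain ⟨U, l, hU, hl, hσ⟩ := exists_eq_unitaryDiag (A := M.coarse ρ)
    (posSemidef_sum_smul hc M.posSemidef)
  rw [hσ, opLog_unitaryDiag hU, trace_mul_unitaryDiag]
  refine sum_mul_log_le_sum_mul_log hc hl ?_ (fun i => M.prob_eq_zero_of_div_eq_zero) ?_ ?_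
  · rw [sum_diagWeight hU, M.sum_prob]
  · exact fun k => diagWeight_eq_zero hU fun v hv =>
      M.mulVec_eq_zero_of_coarse_mulVec_eq_zero hρ (hσ ▸ hv)
  · exact fun t ht => M.sum_diagWeight_mul_inv_le hρ hU hl hc hσ ht

/-- The relative entropy to the coarse-grained state is at most the entropy excess. -/
theorem relEntropy_coarse_le (hρ : ρ.PosSemidef) :
    relEntropy ρ (M.coarse ρ) ≤ ((M.obsEntropy ρ - vonNeumannEntropy ρ : ℝ) : EReal) := by
  rw [relEntropy, if_pos fun v hv => M.mulVec_eq_zero_of_coarse_mulVec_eq_zero hρ hv,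
    EReal.coe_le_coe_iff, Matrix.mul_sub, Matrix.trace_sub, Complex.sub_re, obsEntropy,
    vonNeumannEntropy]
  linarith [M.sum_prob_mul_log_le hρ]

/-- Lower bound on the entropy gap when all coarse-grained states lie in `Ω`. -/
theorem relEntropyDist_le_gap (hρ : ρ.PosSemidef) {χ : Set (POVM X)} {Ω : Set (Matrix X X ℂ)}
    (h : ∀ M ∈ χ, M.coarse ρ ∈ Ω) : relEntropyDist Ω ρ ≤ gap χ ρ := by
  rw [gap, EReal.le_sub_iff_add_le (Or.inl (EReal.coe_ne_bot _)) (Or.inl (EReal.coe_ne_top _))]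
  refine le_iInf₂ fun M hM => ?_
  refine (add_le_add_left ((iInf₂_le _ (h M hM)).trans (M.relEntropy_coarse_le hρ)) _).trans ?_
  rw [← EReal.coe_add]
  simp

end POVM

/-! ### Measurements in an orthonormal basis -/

theorem unitaryDiag_apply (U : Matrix X X ℂ) (p : X → ℝ) (x y : X) :
    unitaryDiag U p x y = ∑ i, (p i : ℂ) * (U x i * star (U y i)) := by
  rw [unitaryDiag, Matrix.mul_apply]
  refine Finset.sum_congr rfl fun i _ => ?_
  rw [mul_diagonal, conjTranspose_apply]
  ring

theorem unitaryDiag_eq_sum_ketbra (U : Matrix X X ℂ) (p : X → ℝ) :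
    unitaryDiag U p = ∑ i, (p i : ℂ) • ketbra fun x => U x i := by
  ext x y
  simp [unitaryDiag_apply, Matrix.sum_apply, ketbra, vecMulVec_apply]

theorem unitaryDiag_posSemidef (U : Matrix X X ℂ) {p : X → ℝ} (hp : ∀ i, 0 ≤ p i) :
    (unitaryDiag U p).PosSemidef := by
  rw [unitaryDiag_eq_sum_ketbra]
  exact posSemidef_sum_smul hp fun i => posSemidef_vecMulVec_self_star _

theorem sum_smul_unitaryDiag {ι : Type} [Fintype ι] (U : Matrix X X ℂ) (c : ι → ℝ)
    (p : ι → X → ℝ) :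
    ∑ j, (c j : ℂ) • unitaryDiag U (p j) = unitaryDiag U fun i => ∑ j, c j * p j i := by
  ext x y
  simp only [Matrix.sum_apply, Matrix.smul_apply, unitaryDiag_apply, smul_eq_mul, Finset.mul_sum,
    Complex.ofReal_sum, Finset.sum_mul, Complex.ofReal_mul]
  rw [Finset.sum_comm]
  exact Finset.sum_congr rfl fun i _ => Finset.sum_congr rfl fun j _ => by ring

theorem trace_unitaryDiag {U : Matrix X X ℂ} (hU : Uᴴ * U = 1) (p : X → ℝ) :
    (unitaryDiag U p).trace = ∑ i, (p i : ℂ) := by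
  rw [unitaryDiag, Matrix.trace_mul_comm, ← Matrix.mul_assoc, hU, Matrix.one_mul, trace_diagonal]

/-- The rank-one projective measurement in the basis given by the columns of `U`. -/
def basisPOVM (U : Matrix X X ℂ) (hU : Uᴴ * U = 1) : POVM X where
  Outcome := X
  op i := unitaryDiag U (Pi.single i 1)
  posSemidef i := unitaryDiag_posSemidef U fun j => by
    by_cases h : j = i
    · subst h
      simp
    · simp [h]
  sum_op := by
    have h := sum_smul_unitaryDiag U (fun _ : X => 1) fun i => Pi.single i 1
    simp only [Complex.ofReal_one, one_smul, one_mul] at h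
    rw [h, ← unitaryDiag_one hU]
    congr 1
    ext i
    simp [Pi.single_apply]

theorem basisPOVM_isProjective (U : Matrix X X ℂ) (hU : Uᴴ * U = 1) :
    (basisPOVM U hU).IsProjective := by
  constructor
  · intro (i : X)
    change unitaryDiag U (Pi.single i 1) * unitaryDiag U (Pi.single i 1) =
      unitaryDiag U (Pi.single i 1)
    rw [unitaryDiag_mul hU]
    congr 1
    ext k
    simp [Pi.single_apply]
  · intro (i : X) (j : X) hij
    change unitaryDiag U (Pi.single i 1) * unitaryDiag U (Pi.single j 1) = 0
    have h : (fun k => (Pi.single i 1 : X → ℝ) k * (Pi.single j 1 : X → ℝ) k) = fun _ => 0 := by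
      ext k
      by_cases hk : k = i
      · subst hk
        simp [Pi.single_eq_of_ne (M := fun _ : X => ℝ) (i := j) (i' := k) hij 1]
      · simp [Pi.single_eq_of_ne hk]
    rw [unitaryDiag_mul hU, h]
    simp [unitaryDiag]

/-- Only the diagonal of `ρ` in the basis `U` enters `Tr ρ log σ`, and Gibbs' inequality says that
the best eigenvalues for `σ` are that diagonal itself. -/
theorem neg_sum_diagWeight_mul_log_le {U ρ : Matrix X X ℂ} (hU : Uᴴ * U = 1) (hρ : IsState ρ)
    {p : X → ℝ} (hp : ∀ i, 0 ≤ p i) (hp1 : ∑ i, p i = 1) :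
    ((-∑ k, diagWeight U ρ k * Real.log (diagWeight U ρ k) - vonNeumannEntropy ρ : ℝ) : EReal)
      ≤ relEntropy ρ (unitaryDiag U p) := by
  rw [relEntropy]
  split_ifs with hker
  · rw [EReal.coe_le_coe_iff, opLog_unitaryDiag hU, Matrix.mul_sub, Matrix.trace_sub,
      Complex.sub_re, trace_mul_unitaryDiag, vonNeumannEntropy]
    have h := sum_mul_log_le_sum_mul_log_self hp (diagWeight_nonneg U hρ.1)
      (by rw [hp1, sum_diagWeight hU, hρ.2, Complex.one_re])
      fun k hk => diagWeight_eq_zero hU hker hk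
    linarith
  · exact le_top

/-- The unitary matrix whose columns form the orthonormal basis `ψ`. -/
noncomputable def basisMatrix (ψ : OrthonormalBasis X ℂ (EuclideanSpace ℂ X)) : Matrix X X ℂ :=
  Matrix.of fun x i => ψ i x

theorem basisMatrix_unitary (ψ : OrthonormalBasis X ℂ (EuclideanSpace ℂ X)) :
    (basisMatrix ψ)ᴴ * basisMatrix ψ = 1 := by
  ext i j
  have h := orthonormal_iff_ite.mp ψ.orthonormal i j
  rw [PiLp.inner_apply] at h
  rw [Matrix.mul_apply, Matrix.one_apply, ← h]
  refine Finset.sum_congr rfl fun x _ => ?_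
  simp [basisMatrix, mul_comm]

/-- Diagonalising the single observable `∑ g_i M_i` with distinct real labels `g_i` diagonalises all
`M_i` at once. -/
theorem POVM.IsProjective.exists_basis {M : POVM X} (hM : M.IsProjective) :
    ∃ (ψ : OrthonormalBasis X ℂ (EuclideanSpace ℂ X)) (f : M.Outcome → X → ℝ),
      (∀ i x, 0 ≤ f i x) ∧ ∀ i, M.op i = unitaryDiag (basisMatrix ψ) (f i) := by
  classical
  obtain ⟨g, hg⟩ : ∃ g : M.Outcome → ℝ, Function.Injective g :=
    ⟨fun i => ((Fintype.equivFin M.Outcome i : ℕ) : ℝ), fun i j h => by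
      apply (Fintype.equivFin M.Outcome).injective
      exact Fin.ext (Nat.cast_injective (R := ℝ) h)⟩
  have hA : (∑ i, (g i : ℂ) • M.op i).IsHermitian := by
    rw [Matrix.IsHermitian, conjTranspose_sum]
    refine Finset.sum_congr rfl fun i _ => ?_
    rw [conjTranspose_smul, (M.posSemidef i).isHermitian.eq]
    simp
  have hmul : ∀ i, M.op i * (∑ j, (g j : ℂ) • M.op j) = (g i : ℂ) • M.op i := by
    intro i
    rw [Matrix.mul_sum, Finset.sum_eq_single i]
    · rw [Matrix.mul_smul, hM.1]
    · intro j _ hj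
      rw [Matrix.mul_smul, hM.2 i j hj.symm, smul_zero]
    · simp
  set V := basisMatrix hA.eigenvectorBasis with hVdef
  have hV : Vᴴ * V = 1 := basisMatrix_unitary _
  have hV' := mul_eq_one_comm.mp hV
  set μ := hA.eigenvalues with hμ
  have hspec : ∑ i, (g i : ℂ) • M.op i = unitaryDiag V μ := hA.spectral_theorem
  -- From `M_i A = g_i M_i` for the observable `A`: in its eigenbasis, column `b` of `M_i` vanishes
  -- unless `μ b = g i`.
  have hQ : ∀ i a b, (Vᴴ * M.op i * V) a b ≠ 0 → μ b = g i := by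
    intro i a b hab
    have h1 : (Vᴴ * M.op i * V) * diagonal (fun k => (μ k : ℂ))
        = (g i : ℂ) • (Vᴴ * M.op i * V) := by
      calc _ = Vᴴ * (M.op i * (V * diagonal (fun k => (μ k : ℂ)) * (Vᴴ * V))) := by
            rw [hV, Matrix.mul_one]
            simp only [Matrix.mul_assoc]
        _ = Vᴴ * (M.op i * unitaryDiag V μ) * V := by
            simp only [unitaryDiag, Matrix.mul_assoc]
        _ = _ := by
            rw [← hspec, hmul, Matrix.mul_smul, Matrix.smul_mul]
    have h2 := congrFun (congrFun h1 a) b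
    rw [mul_diagonal, Matrix.smul_apply, smul_eq_mul, mul_comm] at h2
    exact_mod_cast mul_right_cancel₀ hab h2
  have hone : ∀ a b, ∑ i, (Vᴴ * M.op i * V) a b = (1 : Matrix X X ℂ) a b := by
    intro a b
    rw [← Matrix.sum_apply, ← Matrix.sum_mul, ← Matrix.mul_sum, M.sum_op, Matrix.mul_one, hV]
  refine ⟨hA.eigenvectorBasis, fun i b => if μ b = g i then 1 else 0, fun i b => ?_, fun i => ?_⟩
  · positivity
  · have hdiag : Vᴴ * M.op i * V
        = diagonal fun b => (((if μ b = g i then 1 else 0 : ℝ)) : ℂ) := by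
      ext a b
      by_cases hb : μ b = g i
      -- By injectivity of `g` only `M_i` contributes to column `b`, so that column is the column of
      -- the identity.
      · have h1 := hone a b
        rw [Finset.sum_eq_single i] at h1
        · rw [h1]
          by_cases hab : a = b
          · subst hab
            simp [hb]
          · simp [hab]
        · intro j _ hj
          by_contra hne
          exact hj (hg ((hQ j a b hne).symm.trans hb))
        · simp
      · have h0 : (Vᴴ * M.op i * V) a b = 0 := by
          by_contra hne
          exact hb (hQ i a b hne)
        rw [h0]
        by_cases hab : a = b
        · subst hab
          simp [hb]
        · simp [hab]
    rw [unitaryDiag, ← hVdef, ← hdiag]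
    calc M.op i = (V * Vᴴ) * M.op i * (V * Vᴴ) := by
          rw [hV', Matrix.one_mul, Matrix.mul_one]
      _ = _ := by simp only [Matrix.mul_assoc]

theorem exists_state_eq_trace_smul [Nonempty X] {A : Matrix X X ℂ} (hA : A.PosSemidef) :
    ∃ τ, IsState τ ∧ A = (A.trace.re : ℂ) • τ := by
  by_cases h : A = 0
  · refine ⟨((Fintype.card X : ℝ)⁻¹ : ℂ) • 1, ⟨PosSemidef.one.smul ?_, ?_⟩, by simp [h]⟩
    · exact_mod_cast inv_nonneg.mpr (Nat.cast_nonneg (α := ℝ) (Fintype.card X))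
    · simp [Matrix.trace_smul, Matrix.trace_one]
  · have h0 : A.trace ≠ 0 := fun h0 => h (hA.trace_eq_zero_iff.mp h0)
    rw [ofReal_trace_re hA]
    refine ⟨A.trace⁻¹ • A, ⟨hA.smul ?_, ?_⟩, ?_⟩
    · rw [← ofReal_trace_re hA]
      exact_mod_cast inv_nonneg.mpr (Complex.le_def.mp hA.trace_nonneg).1
    · rw [Matrix.trace_smul, smul_eq_mul, inv_mul_cancel₀ h0]
    · rw [smul_smul, mul_inv_cancel₀ h0, one_smul]

end General

/-! ### Product bases and membership of coarse-grained states in the three classes. -/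

section Multipartite

variable {n : ℕ} {d : Fin n → ℕ}

theorem tensorOp_smul (c : Fin n → ℂ) (A : (k : Fin n) → Matrix (Fin (d k)) (Fin (d k)) ℂ) :
    tensorOp (fun k => c k • A k) = (∏ k, c k) • tensorOp A := by
  ext x y
  simp [tensorOp, Finset.prod_mul_distrib]

theorem tensorOp_diagonal (p : (k : Fin n) → Fin (d k) → ℂ) :
    tensorOp (fun k => diagonal (p k)) = diagonal fun x : Idx d => ∏ k, p k (x k) := by
  ext x y
  simp only [tensorOp, Matrix.of_apply]
  by_cases h : x = y
  · subst h
    simp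
  · obtain ⟨k, hk⟩ := Function.ne_iff.mp h
    rw [diagonal_apply_ne _ h]
    exact Finset.prod_eq_zero (Finset.mem_univ k) (diagonal_apply_ne _ hk)

theorem tensorOp_unitaryDiag (U : (k : Fin n) → Matrix (Fin (d k)) (Fin (d k)) ℂ)
    (p : (k : Fin n) → Fin (d k) → ℝ) :
    tensorOp (fun k => unitaryDiag (U k) (p k))
      = unitaryDiag (tensorOp U) fun x => ∏ k, p k (x k) := by
  simp only [unitaryDiag, Complex.ofReal_prod]
  rw [← tensorOp_diagonal fun k i => (p k i : ℂ), tensorOp_conjTranspose, tensorOp_mul,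
    tensorOp_mul]

theorem tensorOp_unitary {U : (k : Fin n) → Matrix (Fin (d k)) (Fin (d k)) ℂ}
    (hU : ∀ k, (U k)ᴴ * U k = 1) : (tensorOp U)ᴴ * tensorOp U = 1 := by
  rw [tensorOp_conjTranspose, tensorOp_mul, ← tensorOp_one]
  exact congrArg tensorOp (funext hU)

theorem mem_ccStates_iff {σ : Matrix (Idx d) (Idx d) ℂ} :
    σ ∈ ccStates d ↔
      ∃ (ψ : (k : Fin n) → OrthonormalBasis (Fin (d k)) ℂ (EuclideanSpace ℂ (Fin (d k))))
        (p : Idx d → ℝ), (∀ i, 0 ≤ p i) ∧ ∑ i, p i = 1 ∧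
        σ = unitaryDiag (tensorOp fun k => basisMatrix (ψ k)) p := by
  simp only [unitaryDiag_eq_sum_ketbra]
  rfl

theorem coarse_mem_ccStates {ρ : Matrix (Idx d) (Idx d) ℂ} (hρ : IsState ρ) {M : POVM (Idx d)}
    (hM : M ∈ LOstar d) : M.coarse ρ ∈ ccStates d := by
  obtain ⟨P, hP, rfl⟩ := hM
  choose ψ f hf hop using fun k => (hP k).exists_basis
  have hU := tensorOp_unitary fun k => basisMatrix_unitary (ψ k)
  have hop' : ∀ i, (tensorPOVM P).op i
      = unitaryDiag (tensorOp fun k => basisMatrix (ψ k)) fun x => ∏ k, f k (i k) (x k) := by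
    intro i
    rw [← tensorOp_unitaryDiag]
    exact congrArg tensorOp (funext fun k => hop k (i k))
  have hσ : (tensorPOVM P).coarse ρ = unitaryDiag (tensorOp fun k => basisMatrix (ψ k))
      fun x => ∑ i, (tensorPOVM P).prob ρ i / (tensorPOVM P).volume i * ∏ k, f k (i k) (x k) := by
    rw [← sum_smul_unitaryDiag, POVM.coarse]
    exact Finset.sum_congr rfl fun i _ => by rw [hop']
  refine mem_ccStates_iff.mpr ⟨ψ, _, fun x => ?_, ?_, hσ⟩
  · exact Finset.sum_nonneg fun i _ => mul_nonneg
      (div_nonneg (POVM.prob_nonneg _ hρ.1 i) (POVM.volume_nonneg _ i))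
      (Finset.prod_nonneg fun k _ => hf k (i k) (x k))
  -- The eigenvalues sum to one because the coarse-grained state has trace one.
  · have h := ((tensorPOVM P).coarse_isState hρ).2
    rw [hσ, trace_unitaryDiag hU] at h
    exact_mod_cast h

theorem tensorPOVM_basisPOVM_op {U : (k : Fin n) → Matrix (Fin (d k)) (Fin (d k)) ℂ}
    (hU : ∀ k, (U k)ᴴ * U k = 1) (i : Idx d) :
    (tensorPOVM fun k => basisPOVM (U k) (hU k)).op i
      = unitaryDiag (tensorOp U) (Pi.single i 1) := by
  change tensorOp (fun k => unitaryDiag (U k) (Pi.single (i k) 1)) = _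
  rw [tensorOp_unitaryDiag]
  congr 1
  ext x
  by_cases h : x = i
  · subst h
    simp
  · obtain ⟨k, hk⟩ := Function.ne_iff.mp h
    rw [Pi.single_eq_of_ne h]
    exact Finset.prod_eq_zero (Finset.mem_univ k) (Pi.single_eq_of_ne hk _)

/-- All volumes are `1`, so observational entropy reduces to the Shannon entropy of the diagonal. -/
theorem obsEntropy_tensorPOVM_basisPOVM
    {U : (k : Fin n) → Matrix (Fin (d k)) (Fin (d k)) ℂ} (hU : ∀ k, (U k)ᴴ * U k = 1)
    (ρ : Matrix (Idx d) (Idx d) ℂ) :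
    (tensorPOVM fun k => basisPOVM (U k) (hU k)).obsEntropy ρ
      = -∑ k, diagWeight (tensorOp U) ρ k * Real.log (diagWeight (tensorOp U) ρ k) := by
  rw [POVM.obsEntropy]
  congr 1
  refine Fintype.sum_equiv (Equiv.refl (Idx d)) _ _ fun i => ?_
  have hp : (tensorPOVM fun k => basisPOVM (U k) (hU k)).prob ρ i
      = diagWeight (tensorOp U) ρ i := by
    change (ρ * (tensorPOVM fun k => basisPOVM (U k) (hU k)).op i).trace.re = _
    rw [tensorPOVM_basisPOVM_op hU i, trace_mul_unitaryDiag]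
    simp [Pi.single_apply]
  have hv : (tensorPOVM fun k => basisPOVM (U k) (hU k)).volume i = 1 := by
    change ((tensorPOVM fun k => basisPOVM (U k) (hU k)).op i).trace.re = _
    rw [tensorPOVM_basisPOVM_op hU i, trace_unitaryDiag (tensorOp_unitary hU),
      ← Complex.ofReal_sum]
    simp
  rw [hp, hv, div_one]
  rfl

theorem gap_LOstar_le {ρ : Matrix (Idx d) (Idx d) ℂ} (hρ : IsState ρ) :
    gap (LOstar d) ρ ≤ relEntropyDist (ccStates d) ρ := by
  refine le_iInf₂ fun σ hσ => ?_
  obtain ⟨ψ, p, hp, hp1, rfl⟩ := mem_ccStates_iff.mp hσ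
  have hU := fun k => basisMatrix_unitary (ψ k)
  refine le_trans ?_ (neg_sum_diagWeight_mul_log_le (tensorOp_unitary hU) hρ hp hp1)
  rw [← obsEntropy_tensorPOVM_basisPOVM hU, EReal.coe_sub, gap]
  exact EReal.sub_le_sub
    (iInf₂_le _ ⟨_, fun k => basisPOVM_isProjective (basisMatrix (ψ k)) (hU k), rfl⟩) le_rfl

theorem mem_sepStates_of_sum {ι : Type} [Fintype ι] {c : ι → ℝ} (hc : ∀ j, 0 ≤ c j)
    {B : ι → (k : Fin n) → Matrix (Fin (d k)) (Fin (d k)) ℂ} (hB : ∀ j k, (B j k).PosSemidef)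
    (h : IsState (∑ j, (c j : ℂ) • tensorOp (B j))) :
    ∑ j, (c j : ℂ) • tensorOp (B j) ∈ sepStates d := by
  -- Unit trace excludes a zero-dimensional system, so every factor admits a state for
  -- normalisation.
  have hne : Nonempty (Idx d) := by
    by_contra hempty
    rw [not_nonempty_iff] at hempty
    have := h.2
    simp [Matrix.trace] at this
  obtain ⟨x⟩ := hne
  have : ∀ k, Nonempty (Fin (d k)) := fun k => ⟨x k⟩
  choose τ hτ hBτ using fun j k => exists_state_eq_trace_smul (hB j k)
  have htr : ∀ j, (tensorOp (τ j)).trace = 1 := by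
    intro j
    have h1 : (tensorOp (τ j)).trace = ∏ k, (τ j k).trace := by
      simp only [Matrix.trace, diag_apply, tensorOp, Matrix.of_apply]
      rw [Finset.prod_univ_sum, Fintype.piFinset_univ]
    rw [h1]
    exact Finset.prod_eq_one fun k _ => (hτ j k).2
  -- The traces of the local factors are absorbed into the weights.
  set q : ι → ℝ := fun j => c j * ∏ k, (B j k).trace.re with hq
  have hterm : ∀ j, (c j : ℂ) • tensorOp (B j) = (q j : ℂ) • tensorOp (τ j) := by
    intro j
    have h1 : tensorOp (B j) = (∏ k, ((B j k).trace.re : ℂ)) • tensorOp (τ j) := by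
      rw [← tensorOp_smul]
      exact congrArg tensorOp (funext fun k => hBτ j k)
    rw [h1, smul_smul, hq]
    push_cast
    rfl
  simp only [hterm] at h ⊢
  let e := Fintype.equivFin ι
  refine ⟨Fintype.card ι, fun j => q (e.symm j), fun j => τ (e.symm j), fun j => ?_, ?_,
    fun j k => hτ _ k, ?_⟩
  · exact mul_nonneg (hc _) (Finset.prod_nonneg fun k _ =>
      (Complex.le_def.mp (hB _ k).trace_nonneg).1)
  · rw [e.symm.sum_comp q]
    have h2 := h.2
    rw [Matrix.trace_sum] at h2
    simp only [Matrix.trace_smul, htr, smul_eq_mul, mul_one] at h2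
    exact_mod_cast h2
  · exact (e.symm.sum_comp fun j => (q j : ℂ) • tensorOp (τ j)).symm

theorem coarse_mem_sepStates {ρ : Matrix (Idx d) (Idx d) ℂ} (hρ : IsState ρ) {M : POVM (Idx d)}
    (hM : M ∈ SEP d) : M.coarse ρ ∈ sepStates d := by
  choose m B hB hop using hM
  have h : M.coarse ρ = ∑ j : (i : M.Outcome) × Fin (m i),
      ((M.prob ρ j.1 / M.volume j.1 : ℝ) : ℂ) • tensorOp (B j.1 j.2) := by
    rw [Fintype.sum_sigma, POVM.coarse]
    exact Finset.sum_congr rfl fun i _ => by rw [hop i, Finset.smul_sum]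
  have hs := M.coarse_isState hρ
  rw [h] at hs ⊢
  exact mem_sepStates_of_sum
    (c := fun j : (i : M.Outcome) × Fin (m i) => M.prob ρ j.1 / M.volume j.1)
    (B := fun j => B j.1 j.2) (fun j => div_nonneg (M.prob_nonneg hρ.1 j.1) (M.volume_nonneg j.1)) (fun j => hB j.1 j.2) hs

theorem coarse_mem_pptStates {ρ : Matrix (Idx d) (Idx d) ℂ} (hρ : IsState ρ) {M : POVM (Idx d)}
    (hM : M ∈ PPT d) : M.coarse ρ ∈ pptStates d := by
  refine ⟨M.coarse_isState hρ, fun S => ?_⟩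
  -- Partial transposition is linear and the coefficients are nonnegative.
  have h : partialTranspose S (M.coarse ρ)
      = ∑ i, ((M.prob ρ i / M.volume i : ℝ) : ℂ) • partialTranspose S (M.op i) := by
    ext x y
    simp only [partialTranspose, POVM.coarse, Matrix.of_apply, Matrix.sum_apply,
      Matrix.smul_apply]
  rw [h]
  exact posSemidef_sum_smul
    (fun i => div_nonneg (M.prob_nonneg hρ.1 i) (M.volume_nonneg i)) fun i => hM i S

end Multipartite

end EntropyGap

theorem mainTheorem3 {n : ℕ} (d : Fin n → ℕ)
    (ρ : Matrix (EntropyGap.Idx d) (EntropyGap.Idx d) ℂ) (hρ : EntropyGap.IsState ρ) :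
    EntropyGap.gap (EntropyGap.LOstar d) ρ = EntropyGap.relEntQuantumness ρ ∧
      EntropyGap.gap (EntropyGap.SEP d) ρ ≥ EntropyGap.relEntEntanglement ρ ∧
      EntropyGap.gap (EntropyGap.PPT d) ρ ≥ EntropyGap.relEntEntanglementPPT ρ :=
  ⟨le_antisymm (EntropyGap.gap_LOstar_le hρ)
      (EntropyGap.POVM.relEntropyDist_le_gap hρ.1 fun _ => EntropyGap.coarse_mem_ccStates hρ),
    EntropyGap.POVM.relEntropyDist_le_gap hρ.1 fun _ => EntropyGap.coarse_mem_sepStates hρ,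
    EntropyGap.POVM.relEntropyDist_le_gap hρ.1 fun _ => EntropyGap.coarse_mem_pptStates hρ⟩
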